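/- A score sheet of a round-robin football tournament between three teams $T_1,T_2,T_3$ is a family of nonnegative integers $g_{ij}$ ($1\le i,j\le 3$, $i\ne j$), where $g_{ij}$ is the number of goals that $T_i$ scored against $T_j$. Put $g_i=\sum_{j\ne i}g_{ij}$; the number of goals of the score sheet is $g_1+g_2+g_3$. The score sheet is called ordered if $g_1\ge g_2\ge g_3$, and runner-up consistent if it is ordered and the score sheet that results from deleting the first row and the first column is again ordered, i.e. $g_{23}\ge g_{32}$. For $G\in\mathbb{Z}_{\ge 0}$ let $Q_r(G)$ denote the number of runner-up consistent score sheets of three teams with $G$ goals (this number is finite). Then the following hold. (1) $Q_r$ is (the restriction to $\mathbb{Z}_{\ge0}$ of) a quasipolynomial of degree $5$ and period $6$ with rational coefficients. That is, there are functions $a_0,\dots,a_5:\mathbb{Z}\to\mathbb{Q}$ such that $Q_r(G)=\sum_{i=0}^5 a_i(G)G^i$ for all $G\ge 0$, $a_5$ is not identically zero, the $a_i$ are periodic, and their smallest positive common period is $6$. (2) As formal power series over $\mathbb{Q}$, $$\sum_{G=0}^{\infty} Q_r(G)t^G=\frac{1+ 4t^2 +3t^3 +6t^4+ 5t^5+ 17t^6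 -2t^7+ 19t^8+ 5t^9+ 8t^{10}+ 3t^{11}+ 8t^{12} -2t^{13}+ 3t^{14}}{(1-t)^2(1-t^3)(1-t^6)^3}.$$ (3) For every integer $G\ge 0$, $$Q_r(G)=\begin{cases} 1+\frac{59}{45}G+\frac{95}{144}G^2+\frac{215}{1296}G^3+\frac{107}{5184}G^4+\frac{13}{12960}G^5 & \text{if } G\equiv 0 \bmod 6,\\ \frac{713}{1728}+\frac{10957}{12960}G+\frac{1453}{2592}G^2+\frac{23}{144}G^3+\frac{107}{5184}G^4+\frac{13}{12960}G^5 & \text{if } G\equiv 1 \bmod 6,\\ \frac{7}{9}+\frac{887}{810}G+\frac{775}{1296}G^2+\frac{23}{144}G^3+\frac{107}{5184}G^4+\frac{13}{12960}G^5 & \text{if } G\equiv 2 \bmod 6,\\ \frac{43}{64}+\frac{1573}{1440}G+\frac{181}{288}G^2+\frac{215}{1296}G^3+\frac{107}{5184}G^4+\frac{13}{12960}G^5 & \text{if } G\equiv 3 \bmod 6,\\ \frac{20}{27}+\frac{431}{405}G+\frac{767}{1296}G^2+\frac{23}{144}G^3+\frac{107}{5184}G^4+\frac{13}{12960}G^5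 & \text{if } G\equiv 4 \bmod 6,\\ \frac{259}{576}+\frac{11357}{12960}G+\frac{1469}{2592}G^2+\frac{23}{144}G^3+\frac{107}{5184}G^4+\frac{13}{12960}G^5 & \text{if } G\equiv 5 \bmod 6. \end{cases}$$ -/

import Mathlib

/-- A score sheet of a round-robin tournament between `n` teams: `goals i j` is the number of
goals that team `i` scored against team `j`. The diagonal carries no information (it is printed
as an asterisk); it is filled with zeros, so that distinct terms are distinct score sheets. -/
@[ext]
structure ScoreSheet (n : ℕ) where
  goals : Fin n → Fin n → ℕ
  diag : ∀ i, goals i i = 0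

namespace ScoreSheet

/-- The total number of goals scored by team `i`. -/
def teamGoals {n : ℕ} (S : ScoreSheet n) (i : Fin n) : ℕ :=
  ∑ j ∈ Finset.univ.filter (fun j => j ≠ i), S.goals i j

/-- The total number of goals of the tournament (the degree of the score sheet). -/
def totalGoals {n : ℕ} (S : ScoreSheet n) : ℕ :=
  ∑ i, S.teamGoals i

/-- Ordered score sheets: the totals of the teams are weakly decreasing. -/
def IsOrdered {n : ℕ} (S : ScoreSheet n) : Prop :=
  ∀ i j : Fin n, i ≤ j → S.teamGoals j ≤ S.teamGoals i

/-- The score sheet obtained by deleting the first row and the first column. -/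
def deleteFirst {n : ℕ} (S : ScoreSheet (n + 1)) : ScoreSheet n where
  goals i j := S.goals i.succ j.succ
  diag i := S.diag i.succ

/-- Runner-up consistent score sheets: ordered, and still ordered after the first team has been
removed. -/
def IsRunnerUpConsistent {n : ℕ} (S : ScoreSheet (n + 1)) : Prop :=
  S.IsOrdered ∧ S.deleteFirst.IsOrdered

/-- The runner-up consistent score sheets of three teams with `G` goals in total. -/
def runnerUpSheets (G : ℕ) : Set (ScoreSheet 3) :=
  {S | S.IsRunnerUpConsistent ∧ S.totalGoals = G}

/-- The number of runner-up consistent score sheets of three teams with `G` goals in total. -/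
noncomputable def Qr (G : ℕ) : ℕ :=
  (runnerUpSheets G).ncard

end ScoreSheet

/-- `Q` is a quasipolynomial with rational coefficients, of degree `d` and period `p`:
`Q n = a_d(n) n ^ d + ⋯ + a_1(n) n + a_0(n)` with periodic coefficient functions `a_i`, where
`a_d` is not the zero function, and `p` is the smallest positive common period of the `a_i`. -/
def IsQuasiPolynomial (Q : ℤ → ℚ) (d p : ℕ) : Prop :=
  ∃ a : ℕ → ℤ → ℚ,
    (∀ n : ℤ, Q n = ∑ i ∈ Finset.range (d + 1), a i n * (n : ℚ) ^ i) ∧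
    (∃ n : ℤ, a d n ≠ 0) ∧
    IsLeast {q : ℕ | 0 < q ∧ ∀ i ≤ d, ∀ n m : ℤ, a i (n + m * (q : ℤ)) = a i n} p

/-! A sheet is fixed by `z = g₃`, `y = g₂ - g₃`, the goals `a` of `T₁` against `T₂`, and the goals
`f ≤ d` in the match of `T₃` and `T₂`. For given `z`, `y` the number of choices is the product of `G
- 2z - y + 1` for `a` and `(z + 1)(z + 2y + 2)/2` for `(f, d)`. Summing over `y ≤ (G - 3z)/2` gives
a polynomial in `z`, apart from a floor that depends on the parity of `G - z` (`Qr_eq_sum`). Pairing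
`z = 2w` with `z = 2w + 1` and writing `G = 6q + r` removes the floor: each pair is a polynomial of
degree at most 4 in `w`, so Newton's formula sums it (`sum_range_pairSum`) and each residue `r`
yields a polynomial in `q`. The series identity is then a linear recurrence of order 23 plus
finitely many initial values. -/

namespace ScoreSheet

/-! ### Parametrization of the score sheets -/

/-- The score sheet of three teams in which `T₃` scores `z` goals, `T₂` scores `z + y` goals and
`T₁` scores `G - 2 * z - y` goals, where `T₁` scores `a` goals against `T₂`, `T₃` scores `f` goals
against `T₂`, and `T₂` scores `d` goals against `T₃`. -/
def ofParams (G : ℕ) (p : Σ _ : ℕ, Σ _ : ℕ, Σ _ : ℕ, Σ _ : ℕ, ℕ) : ScoreSheet 3 where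
  goals := ![![0, p.2.2.1, G - 2 * p.1 - p.2.1 - p.2.2.1],
    ![p.1 + p.2.1 - p.2.2.2.2, 0, p.2.2.2.2],
    ![p.1 - p.2.2.2.1, p.2.2.2.1, 0]]
  diag i := by fin_cases i <;> rfl

/-- The parameters of the runner-up consistent score sheets with `G` goals. -/
def params (G : ℕ) : Finset (Σ _ : ℕ, Σ _ : ℕ, Σ _ : ℕ, Σ _ : ℕ, ℕ) :=
  (Finset.range (G / 3 + 1)).sigma fun z =>
    (Finset.range ((G - 3 * z) / 2 + 1)).sigma fun y =>
      (Finset.range (G - 2 * z - y + 1)).sigma fun _ =>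
        (Finset.range (z + 1)).sigma fun f => Finset.Ico f (z + y + 1)

theorem mem_runnerUpSheets_iff {G : ℕ} {S : ScoreSheet 3} :
    S ∈ runnerUpSheets G ↔
      S.goals 1 0 + S.goals 1 2 ≤ S.goals 0 1 + S.goals 0 2 ∧
      S.goals 2 0 + S.goals 2 1 ≤ S.goals 1 0 + S.goals 1 2 ∧
      S.goals 2 1 ≤ S.goals 1 2 ∧
      (S.goals 0 1 + S.goals 0 2) + (S.goals 1 0 + S.goals 1 2) +
        (S.goals 2 0 + S.goals 2 1) = G := by
  have h0 : S.teamGoals 0 = S.goals 0 1 + S.goals 0 2 := by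
    simp [teamGoals, Finset.sum_filter, Fin.sum_univ_three]
  have h1 : S.teamGoals 1 = S.goals 1 0 + S.goals 1 2 := by
    simp [teamGoals, Finset.sum_filter, Fin.sum_univ_three]
  have h2 : S.teamGoals 2 = S.goals 2 0 + S.goals 2 1 := by
    simp [teamGoals, Finset.sum_filter, Fin.sum_univ_three]
  have k0 : S.deleteFirst.teamGoals 0 = S.goals 1 2 := by
    simp [teamGoals, Finset.sum_filter, deleteFirst]
  have k1 : S.deleteFirst.teamGoals 1 = S.goals 2 1 := by
    simp [teamGoals, Finset.sum_filter, deleteFirst]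
  simp only [runnerUpSheets, IsRunnerUpConsistent, IsOrdered, Set.mem_ofPred_eq, totalGoals,
    Fin.forall_fin_succ, Fin.sum_univ_three]
  simp [h0, h1, h2, k0, k1]
  omega

theorem image_ofParams (G : ℕ) : ofParams G '' (params G : Set _) = runnerUpSheets G := by
  ext S
  constructor
  · rintro ⟨⟨z, y, a, f, d⟩, hp, rfl⟩
    simp only [params, Finset.mem_coe, Finset.mem_sigma, Finset.mem_range, Finset.mem_Ico] at hp
    rw [mem_runnerUpSheets_iff]
    simp [ofParams]
    omega
  · intro hS
    rw [mem_runnerUpSheets_iff] at hS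
    refine ⟨⟨S.goals 2 0 + S.goals 2 1,
      S.goals 1 0 + S.goals 1 2 - (S.goals 2 0 + S.goals 2 1), S.goals 0 1, S.goals 2 1,
      S.goals 1 2⟩, ?_, ?_⟩
    · simp only [params, Finset.mem_coe, Finset.mem_sigma, Finset.mem_range, Finset.mem_Ico]
      omega
    · ext i j
      have h0 := S.diag 0
      have h1 := S.diag 1
      have h2 := S.diag 2
      fin_cases i <;> fin_cases j <;> simp [ofParams] <;> omega

theorem injOn_ofParams (G : ℕ) : Set.InjOn (ofParams G) (params G : Set _) := by
  rintro ⟨z, y, a, f, d⟩ hp ⟨z', y', a', f', d'⟩ hp' h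
  simp only [params, Finset.mem_coe, Finset.mem_sigma, Finset.mem_range, Finset.mem_Ico] at hp hp'
  have e (i j) : (ofParams G ⟨z, y, a, f, d⟩).goals i j =
      (ofParams G ⟨z', y', a', f', d'⟩).goals i j := by rw [h]
  have e01 := e 0 1
  have e10 := e 1 0
  have e12 := e 1 2
  have e20 := e 2 0
  have e21 := e 2 1
  simp [ofParams] at e01 e10 e12 e20 e21
  obtain rfl : z = z' := by omega
  obtain rfl : y = y' := by omega
  subst e01 e12 e21
  rfl

theorem finite_runnerUpSheets (G : ℕ) : (runnerUpSheets G).Finite := by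
  rw [← image_ofParams]
  exact (params G).finite_toSet.image _

theorem Qr_eq_card (G : ℕ) : Qr G = (params G).card := by
  rw [Qr, ← image_ofParams, (injOn_ofParams G).ncard_image, Set.ncard_coe_finset]

/-! ### Summation over the scores for fixed `z` -/

theorem sum_range_sub_cast (z y : ℕ) :
    ((∑ f ∈ Finset.range (z + 1), (z + y + 1 - f) : ℕ) : ℚ) =
      ((z : ℚ) + 1) * (z + 2 * y + 2) / 2 := by
  -- The bound on `n` keeps the truncated subtraction `z + y + 1 - f` exact during the induction.
  have key : ∀ n ≤ z + 1, ((∑ f ∈ Finset.range n, (z + y + 1 - f) : ℕ) : ℚ) =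
      (n : ℚ) * (2 * (z + y + 1) - n + 1) / 2 := by
    intro n
    induction n with
    | zero => simp
    | succ n ih =>
      intro hn
      rw [Finset.sum_range_succ, Nat.cast_add, ih (by omega), Nat.cast_sub (by omega)]
      push_cast
      ring
  rw [key _ le_rfl]
  push_cast
  ring

/-- The closed form of `∑ y < n, (m - y + z + 1) * ((z + 1) * (z + 2 * y + 2) / 2)`. -/
def innerSum (n m z : ℚ) : ℚ :=
  (z + 1) / 2 * ((m + z + 1) * (z + 2) * n + (2 * (m + z + 1) - (z + 2)) * (n * (n - 1) / 2) -
    n * (n - 1) * (2 * n - 1) / 3)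

theorem sum_range_eq_innerSum (n : ℕ) (m z : ℚ) :
    ∑ y ∈ Finset.range n, (m - y + z + 1) * ((z + 1) * (z + 2 * y + 2) / 2) =
      innerSum n m z := by
  induction n with
  | zero => simp [innerSum]
  | succ n ih =>
    rw [Finset.sum_range_succ, ih]
    simp only [innerSum]
    push_cast
    ring

theorem Qr_eq_sum (G : ℕ) : (Qr G : ℚ) = ∑ z ∈ Finset.range (G / 3 + 1),
    innerSum (((G - 3 * z) / 2 + 1 : ℕ) : ℚ) ((G : ℚ) - 3 * z) z := by
  rw [Qr_eq_card, params, Finset.card_sigma, Nat.cast_sum]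
  refine Finset.sum_congr rfl fun z hz => ?_
  rw [Finset.mem_range] at hz
  rw [Finset.card_sigma, Nat.cast_sum, ← sum_range_eq_innerSum]
  refine Finset.sum_congr rfl fun y hy => ?_
  rw [Finset.mem_range] at hy
  simp only [Finset.card_sigma, Nat.card_Ico, Finset.sum_const, Finset.card_range, smul_eq_mul]
  rw [Nat.cast_mul, sum_range_sub_cast]
  congr 1
  -- The ranges of `z` and `y` give `2z + y ≤ G`, so nothing is truncated.
  have : G - 2 * z - y + 1 + 2 * z + y = G + 1 := by omega
  have h : ((G - 2 * z - y + 1 : ℕ) : ℚ) + 2 * z + y = G + 1 := by exact_mod_cast this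
  linarith

/-! ### Summation over `z` in pairs of consecutive values -/

theorem sum_range_two_mul {M : Type*} [AddCommMonoid M] (g : ℕ → M) (n : ℕ) :
    ∑ z ∈ Finset.range (2 * n), g z = ∑ w ∈ Finset.range n, (g (2 * w) + g (2 * w + 1)) := by
  induction n with
  | zero => simp
  | succ n ih =>
    rw [Nat.mul_succ, Finset.sum_range_succ, Finset.sum_range_succ, Finset.sum_range_succ, ih,
      add_assoc]

/-- Newton's summation formula for polynomials of degree at most four. -/
theorem sum_range_newton (e d₁ d₂ d₃ d₄ : ℚ) (n : ℕ) :
    ∑ w ∈ Finset.range n, (e + d₁ * w + d₂ * (w * (w - 1) / 2) +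
        d₃ * (w * (w - 1) * (w - 2) / 6) + d₄ * (w * (w - 1) * (w - 2) * (w - 3) / 24)) =
      n * e + n * (n - 1) / 2 * d₁ + n * (n - 1) * (n - 2) / 6 * d₂ +
        n * (n - 1) * (n - 2) * (n - 3) / 24 * d₃ +
        n * (n - 1) * (n - 2) * (n - 3) * (n - 4) / 120 * d₄ := by
  induction n with
  | zero => simp
  | succ n ih =>
    rw [Finset.sum_range_succ, ih]
    push_cast
    ring

/-- The contribution to `Qr (6 * q + r)` of the score sheets in which `T₃` scores `2 * w` or
`2 * w + 1` goals, if `α = r / 2` and `β = (r - 3) / 2`, rounded down. -/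
def pairSum (r α β q w : ℚ) : ℚ :=
  innerSum (3 * (q - w) + α + 1) (6 * (q - w) + r) (2 * w) +
    innerSum (3 * (q - w) + β + 1) (6 * (q - w) + r - 3) (2 * w + 1)

/-- For fixed `q`, both summands have degree at most 4 in `w`, so the forward differences at 0 up to
order 4 determine the polynomial. -/
theorem pairSum_eq_newton (r α β q w : ℚ) :
    pairSum r α β q w = pairSum r α β q 0 + (pairSum r α β q 1 - pairSum r α β q 0) * w +
      (pairSum r α β q 2 - 2 * pairSum r α β q 1 + pairSum r α β q 0) * (w * (w - 1) / 2) +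
      (pairSum r α β q 3 - 3 * pairSum r α β q 2 + 3 * pairSum r α β q 1 - pairSum r α β q 0) *
        (w * (w - 1) * (w - 2) / 6) +
      (pairSum r α β q 4 - 4 * pairSum r α β q 3 + 6 * pairSum r α β q 2 -
        4 * pairSum r α β q 1 + pairSum r α β q 0) *
        (w * (w - 1) * (w - 2) * (w - 3) / 24) := by
  simp only [pairSum, innerSum]
  ring

theorem sum_range_pairSum (r α β q : ℚ) (n : ℕ) :
    ∑ w ∈ Finset.range n, pairSum r α β q w =
      n * pairSum r α β q 0 + n * (n - 1) / 2 * (pairSum r α β q 1 - pairSum r α β q 0) +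
      n * (n - 1) * (n - 2) / 6 *
        (pairSum r α β q 2 - 2 * pairSum r α β q 1 + pairSum r α β q 0) +
      n * (n - 1) * (n - 2) * (n - 3) / 24 *
        (pairSum r α β q 3 - 3 * pairSum r α β q 2 + 3 * pairSum r α β q 1 -
          pairSum r α β q 0) +
      n * (n - 1) * (n - 2) * (n - 3) * (n - 4) / 120 *
        (pairSum r α β q 4 - 4 * pairSum r α β q 3 + 6 * pairSum r α β q 2 -
        4 * pairSum r α β q 1 + pairSum r α β q 0) := by
  rw [← sum_range_newton]
  exact Finset.sum_congr rfl fun w _ => pairSum_eq_newton r α β q w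

/-- Lowering `G - 3z` by 6 lowers its half by exactly 3, so the floors are linear in `w`. Since `⌊(r
- 3)/2⌋` may be negative, it is written as `b - 3`; `hw` prevents truncation. -/
theorem innerSum_add_innerSum_eq_pairSum {q r w a b : ℕ} (hw : 6 * w + 3 ≤ 6 * q + r)
    (ha : r / 2 = a) (hb : (r + 3) / 2 = b) :
    innerSum (((6 * q + r - 3 * (2 * w)) / 2 + 1 : ℕ) : ℚ)
        (((6 * q + r : ℕ) : ℚ) - 3 * (2 * w : ℕ)) (2 * w : ℕ) +
      innerSum (((6 * q + r - 3 * (2 * w + 1)) / 2 + 1 : ℕ) : ℚ)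
        (((6 * q + r : ℕ) : ℚ) - 3 * (2 * w + 1 : ℕ)) (2 * w + 1 : ℕ) =
      pairSum r a (b - 3) q w := by
  have h1 : (6 * q + r - 3 * (2 * w)) / 2 + 3 * w = 3 * q + a := by omega
  have h2 : (6 * q + r - 3 * (2 * w + 1)) / 2 + 3 * w + 3 = 3 * q + b := by omega
  have h1' : (((6 * q + r - 3 * (2 * w)) / 2 : ℕ) : ℚ) = 3 * (q - w) + a := by
    have : (((6 * q + r - 3 * (2 * w)) / 2 : ℕ) : ℚ) + 3 * w = 3 * q + a := by exact_mod_cast h1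
    linarith
  have h2' : (((6 * q + r - 3 * (2 * w + 1)) / 2 : ℕ) : ℚ) = 3 * (q - w) + (b - 3) := by
    have : (((6 * q + r - 3 * (2 * w + 1)) / 2 : ℕ) : ℚ) + 3 * w + 3 = 3 * q + b := by
      exact_mod_cast h2
    linarith
  rw [pairSum, Nat.cast_succ, h1', Nat.cast_succ, h2']
  push_cast
  congr 2 <;> ring

/-- Here `G / 3 = 2q`, so the last value `z = 2q` has no partner. -/
theorem Qr_of_lt_three {q r a b : ℕ} (hr : r < 3) (ha : r / 2 = a) (hb : (r + 3) / 2 = b) :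
    (Qr (6 * q + r) : ℚ) = ∑ w ∈ Finset.range q, pairSum r a (b - 3) q w +
      innerSum (a + 1) r (2 * q) := by
  rw [Qr_eq_sum, show (6 * q + r) / 3 + 1 = 2 * q + 1 by omega, Finset.sum_range_succ,
    sum_range_two_mul]
  congr 1
  · refine Finset.sum_congr rfl fun w hw => ?_
    rw [Finset.mem_range] at hw
    exact innerSum_add_innerSum_eq_pairSum (by omega) ha hb
  · rw [show (6 * q + r - 3 * (2 * q)) / 2 = a by omega]
    push_cast
    congr 1
    ring

/-- Here `G / 3 = 2q + 1`, so the pairs exhaust the range. -/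
theorem Qr_of_three_le {q r a b : ℕ} (hr : 3 ≤ r) (hr' : r < 6) (ha : r / 2 = a)
    (hb : (r + 3) / 2 = b) :
    (Qr (6 * q + r) : ℚ) = ∑ w ∈ Finset.range (q + 1), pairSum r a (b - 3) q w := by
  rw [Qr_eq_sum, show (6 * q + r) / 3 + 1 = 2 * (q + 1) by omega, sum_range_two_mul]
  refine Finset.sum_congr rfl fun w hw => ?_
  rw [Finset.mem_range] at hw
  exact innerSum_add_innerSum_eq_pairSum (by omega) ha hb

/-! ### The six explicit polynomials -/

theorem Qr_of_mod_six_eq_zero {G : ℕ} (h : G % 6 = 0) : (Qr G : ℚ) =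
    1 + 59 / 45 * (G : ℚ) + 95 / 144 * (G : ℚ) ^ 2 + 215 / 1296 * (G : ℚ) ^ 3
      + 107 / 5184 * (G : ℚ) ^ 4 + 13 / 12960 * (G : ℚ) ^ 5 := by
  obtain ⟨q, rfl⟩ : ∃ q, G = 6 * q + 0 := ⟨G / 6, by omega⟩
  rw [Qr_of_lt_three (a := 0) (b := 1) (by norm_num) (by norm_num) (by norm_num), sum_range_pairSum]
  simp only [pairSum, innerSum]
  push_cast
  ring

theorem Qr_of_mod_six_eq_one {G : ℕ} (h : G % 6 = 1) : (Qr G : ℚ) =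
    713 / 1728 + 10957 / 12960 * (G : ℚ) + 1453 / 2592 * (G : ℚ) ^ 2 + 23 / 144 * (G : ℚ) ^ 3
      + 107 / 5184 * (G : ℚ) ^ 4 + 13 / 12960 * (G : ℚ) ^ 5 := by
  obtain ⟨q, rfl⟩ : ∃ q, G = 6 * q + 1 := ⟨G / 6, by omega⟩
  rw [Qr_of_lt_three (a := 0) (b := 2) (by norm_num) (by norm_num) (by norm_num), sum_range_pairSum]
  simp only [pairSum, innerSum]
  push_cast
  ring

theorem Qr_of_mod_six_eq_two {G : ℕ} (h : G % 6 = 2) : (Qr G : ℚ) =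
    7 / 9 + 887 / 810 * (G : ℚ) + 775 / 1296 * (G : ℚ) ^ 2 + 23 / 144 * (G : ℚ) ^ 3
      + 107 / 5184 * (G : ℚ) ^ 4 + 13 / 12960 * (G : ℚ) ^ 5 := by
  obtain ⟨q, rfl⟩ : ∃ q, G = 6 * q + 2 := ⟨G / 6, by omega⟩
  rw [Qr_of_lt_three (a := 1) (b := 2) (by norm_num) (by norm_num) (by norm_num), sum_range_pairSum]
  simp only [pairSum, innerSum]
  push_cast
  ring

theorem Qr_of_mod_six_eq_three {G : ℕ} (h : G % 6 = 3) : (Qr G : ℚ) =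
    43 / 64 + 1573 / 1440 * (G : ℚ) + 181 / 288 * (G : ℚ) ^ 2 + 215 / 1296 * (G : ℚ) ^ 3
      + 107 / 5184 * (G : ℚ) ^ 4 + 13 / 12960 * (G : ℚ) ^ 5 := by
  obtain ⟨q, rfl⟩ : ∃ q, G = 6 * q + 3 := ⟨G / 6, by omega⟩
  rw [Qr_of_three_le (a := 1) (b := 3) (by norm_num) (by norm_num) (by norm_num)
    (by norm_num), sum_range_pairSum]
  simp only [pairSum, innerSum]
  push_cast
  ring

theorem Qr_of_mod_six_eq_four {G : ℕ} (h : G % 6 = 4) : (Qr G : ℚ) =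
    20 / 27 + 431 / 405 * (G : ℚ) + 767 / 1296 * (G : ℚ) ^ 2 + 23 / 144 * (G : ℚ) ^ 3
      + 107 / 5184 * (G : ℚ) ^ 4 + 13 / 12960 * (G : ℚ) ^ 5 := by
  obtain ⟨q, rfl⟩ : ∃ q, G = 6 * q + 4 := ⟨G / 6, by omega⟩
  rw [Qr_of_three_le (a := 2) (b := 3) (by norm_num) (by norm_num) (by norm_num)
    (by norm_num), sum_range_pairSum]
  simp only [pairSum, innerSum]
  push_cast
  ring

theorem Qr_of_mod_six_eq_five {G : ℕ} (h : G % 6 = 5) : (Qr G : ℚ) =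
    259 / 576 + 11357 / 12960 * (G : ℚ) + 1469 / 2592 * (G : ℚ) ^ 2 + 23 / 144 * (G : ℚ) ^ 3
      + 107 / 5184 * (G : ℚ) ^ 4 + 13 / 12960 * (G : ℚ) ^ 5 := by
  obtain ⟨q, rfl⟩ : ∃ q, G = 6 * q + 5 := ⟨G / 6, by omega⟩
  rw [Qr_of_three_le (a := 2) (b := 4) (by norm_num) (by norm_num) (by norm_num)
    (by norm_num), sum_range_pairSum]
  simp only [pairSum, innerSum]
  push_cast
  ring

/-! ### The periodic coefficient functions -/

/-- The coefficients of the quasipolynomial that counts the runner-up consistent score sheets of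
three teams. -/
def runnerUpCoeff (i : ℕ) (n : ℤ) : ℚ :=
  match i with
  | 0 => if n % 6 = 0 then 1 else if n % 6 = 1 then 713 / 1728 else if n % 6 = 2 then 7 / 9
      else if n % 6 = 3 then 43 / 64 else if n % 6 = 4 then 20 / 27 else 259 / 576
  | 1 => if n % 6 = 0 then 59 / 45 else if n % 6 = 1 then 10957 / 12960
      else if n % 6 = 2 then 887 / 810 else if n % 6 = 3 then 1573 / 1440
      else if n % 6 = 4 then 431 / 405 else 11357 / 12960
  | 2 => if n % 6 = 0 then 95 / 144 else if n % 6 = 1 then 1453 / 2592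
      else if n % 6 = 2 then 775 / 1296 else if n % 6 = 3 then 181 / 288
      else if n % 6 = 4 then 767 / 1296 else 1469 / 2592
  | 3 => if n % 3 = 0 then 215 / 1296 else 23 / 144
  | 4 => 107 / 5184
  | _ => 13 / 12960

theorem runnerUpCoeff_zero_eq_one_iff (n : ℤ) : runnerUpCoeff 0 n = 1 ↔ n % 6 = 0 := by
  simp only [runnerUpCoeff]
  split_ifs with h <;> norm_num [h]

theorem runnerUpCoeff_congr (i : ℕ) {n m : ℤ} (h : n % 6 = m % 6) :
    runnerUpCoeff i n = runnerUpCoeff i m := by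
  have h3 : n % 3 = m % 3 := by omega
  unfold runnerUpCoeff
  rw [h, h3]

theorem Qr_eq_sum_runnerUpCoeff (G : ℕ) :
    (Qr G : ℚ) = ∑ i ∈ Finset.range 6, runnerUpCoeff i (G : ℤ) * ((G : ℤ) : ℚ) ^ i := by
  have h : G % 6 < 6 := Nat.mod_lt _ (by norm_num)
  interval_cases hG : G % 6
  · have h6 : (G : ℤ) % 6 = 0 := by omega
    have h3 : (G : ℤ) % 3 = 0 := by omega
    rw [Qr_of_mod_six_eq_zero hG]
    norm_num [Finset.sum_range_succ, runnerUpCoeff, h6, h3]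
  · have h6 : (G : ℤ) % 6 = 1 := by omega
    have h3 : (G : ℤ) % 3 = 1 := by omega
    rw [Qr_of_mod_six_eq_one hG]
    norm_num [Finset.sum_range_succ, runnerUpCoeff, h6, h3]
  · have h6 : (G : ℤ) % 6 = 2 := by omega
    have h3 : (G : ℤ) % 3 = 2 := by omega
    rw [Qr_of_mod_six_eq_two hG]
    norm_num [Finset.sum_range_succ, runnerUpCoeff, h6, h3]
  · have h6 : (G : ℤ) % 6 = 3 := by omega
    have h3 : (G : ℤ) % 3 = 0 := by omega
    rw [Qr_of_mod_six_eq_three hG]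
    norm_num [Finset.sum_range_succ, runnerUpCoeff, h6, h3]
  · have h6 : (G : ℤ) % 6 = 4 := by omega
    have h3 : (G : ℤ) % 3 = 1 := by omega
    rw [Qr_of_mod_six_eq_four hG]
    norm_num [Finset.sum_range_succ, runnerUpCoeff, h6, h3]
  · have h6 : (G : ℤ) % 6 = 5 := by omega
    have h3 : (G : ℤ) % 3 = 2 := by omega
    rw [Qr_of_mod_six_eq_five hG]
    norm_num [Finset.sum_range_succ, runnerUpCoeff, h6, h3]

/-- Once the residue of `n` is fixed, every shifted value becomes an explicit polynomial in `n`, as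
the recurrence needs. -/
theorem Qr_add_eq_sum_runnerUpCoeff (n k : ℕ) :
    (Qr (n + k) : ℚ) =
      ∑ i ∈ Finset.range 6, runnerUpCoeff i ((n % 6 : ℕ) + k) * ((n : ℚ) + k) ^ i := by
  rw [Qr_eq_sum_runnerUpCoeff]
  refine Finset.sum_congr rfl fun i _ => ?_
  rw [runnerUpCoeff_congr i (m := (n % 6 : ℕ) + k) (by omega)]
  push_cast
  rfl

/-! ### The generating series -/

section Series

open PowerSeries

theorem coeff_mk_mul_denominator (f : ℕ → ℚ) (n : ℕ) :
    coeff n (PowerSeries.mk f * ((1 - X) ^ 2 * (1 - X ^ 3) * (1 - X ^ 6) ^ 3)) =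
      f n - 2 * (if 1 ≤ n then f (n - 1) else 0) + (if 2 ≤ n then f (n - 2) else 0)
        - (if 3 ≤ n then f (n - 3) else 0) + 2 * (if 4 ≤ n then f (n - 4) else 0)
        - (if 5 ≤ n then f (n - 5) else 0) - 3 * (if 6 ≤ n then f (n - 6) else 0)
        + 6 * (if 7 ≤ n then f (n - 7) else 0) - 3 * (if 8 ≤ n then f (n - 8) else 0)
        + 3 * (if 9 ≤ n then f (n - 9) else 0) - 6 * (if 10 ≤ n then f (n - 10) else 0)
        + 3 * (if 11 ≤ n then f (n - 11) else 0) + 3 * (if 12 ≤ n then f (n - 12) else 0)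
        - 6 * (if 13 ≤ n then f (n - 13) else 0) + 3 * (if 14 ≤ n then f (n - 14) else 0)
        - 3 * (if 15 ≤ n then f (n - 15) else 0) + 6 * (if 16 ≤ n then f (n - 16) else 0)
        - 3 * (if 17 ≤ n then f (n - 17) else 0) - (if 18 ≤ n then f (n - 18) else 0)
        + 2 * (if 19 ≤ n then f (n - 19) else 0) - (if 20 ≤ n then f (n - 20) else 0)
        + (if 21 ≤ n then f (n - 21) else 0) - 2 * (if 22 ≤ n then f (n - 22) else 0)
        + (if 23 ≤ n then f (n - 23) else 0) := by
  have h : PowerSeries.mk f * ((1 - X) ^ 2 * (1 - X ^ 3) * (1 - X ^ 6) ^ 3) =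
      PowerSeries.mk f - 2 * (PowerSeries.mk f * X ^ 1) + (PowerSeries.mk f * X ^ 2)
        - (PowerSeries.mk f * X ^ 3) + 2 * (PowerSeries.mk f * X ^ 4)
        - (PowerSeries.mk f * X ^ 5) - 3 * (PowerSeries.mk f * X ^ 6)
        + 6 * (PowerSeries.mk f * X ^ 7) - 3 * (PowerSeries.mk f * X ^ 8)
        + 3 * (PowerSeries.mk f * X ^ 9) - 6 * (PowerSeries.mk f * X ^ 10)
        + 3 * (PowerSeries.mk f * X ^ 11) + 3 * (PowerSeries.mk f * X ^ 12)
        - 6 * (PowerSeries.mk f * X ^ 13) + 3 * (PowerSeries.mk f * X ^ 14)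
        - 3 * (PowerSeries.mk f * X ^ 15) + 6 * (PowerSeries.mk f * X ^ 16)
        - 3 * (PowerSeries.mk f * X ^ 17) - (PowerSeries.mk f * X ^ 18)
        + 2 * (PowerSeries.mk f * X ^ 19) - (PowerSeries.mk f * X ^ 20)
        + (PowerSeries.mk f * X ^ 21) - 2 * (PowerSeries.mk f * X ^ 22)
        + (PowerSeries.mk f * X ^ 23) := by
    ring
  have h2 : (2 : ℚ⟦X⟧) = C 2 := (map_ofNat C 2).symm
  have h3 : (3 : ℚ⟦X⟧) = C 3 := (map_ofNat C 3).symm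
  have h6 : (6 : ℚ⟦X⟧) = C 6 := (map_ofNat C 6).symm
  rw [h, h2, h3, h6]
  simp only [map_add, map_sub, coeff_C_mul, coeff_mul_X_pow', coeff_mk]

set_option maxHeartbeats 4000000 in
-- The denominator vanishes to order 6 at 1, 4 at the primitive cube roots of unity and 3 at the
-- other sixth roots. This suffices because the coefficients of `G⁵`, `G⁴` are constant, that of
-- `G³` has period 3, and the lower ones have period 6.
theorem Qr_recurrence (n : ℕ) :
    (Qr (n + 23) : ℚ) - 2 * Qr (n + 22) + Qr (n + 21) - Qr (n + 20) + 2 * Qr (n + 19)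
      - Qr (n + 18) - 3 * Qr (n + 17) + 6 * Qr (n + 16) - 3 * Qr (n + 15) + 3 * Qr (n + 14)
      - 6 * Qr (n + 13) + 3 * Qr (n + 12) + 3 * Qr (n + 11) - 6 * Qr (n + 10) + 3 * Qr (n + 9)
      - 3 * Qr (n + 8) + 6 * Qr (n + 7) - 3 * Qr (n + 6) - Qr (n + 5) + 2 * Qr (n + 4)
      - Qr (n + 3) + Qr (n + 2) - 2 * Qr (n + 1) + Qr n = 0 := by
  have h : n % 6 < 6 := Nat.mod_lt _ (by norm_num)
  have h0 := Qr_add_eq_sum_runnerUpCoeff n 0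
  rw [add_zero] at h0
  simp only [Qr_add_eq_sum_runnerUpCoeff, h0, Finset.sum_range_succ, Finset.sum_range_zero]
  interval_cases n % 6 <;> norm_num [runnerUpCoeff] <;> ring

theorem Qr_initial_values :
    Qr 0 = 1 ∧ Qr 1 = 2 ∧ Qr 2 = 7 ∧ Qr 3 = 16 ∧ Qr 4 = 31 ∧ Qr 5 = 55 ∧ Qr 6 = 103 ∧ Qr 7 = 155 ∧
    Qr 8 = 247 ∧ Qr 9 = 377 ∧ Qr 10 = 537 ∧ Qr 11 = 755 ∧ Qr 12 = 1076 ∧ Qr 13 = 1419 ∧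
    Qr 14 = 1904 ∧ Qr 15 = 2525 ∧ Qr 16 = 3228 ∧ Qr 17 = 4112 ∧ Qr 18 = 5268 ∧ Qr 19 = 6488 ∧
    Qr 20 = 8052 ∧ Qr 21 = 9948 ∧ Qr 22 = 12016 := by
  split_ands <;> rw [← Nat.cast_inj (R := ℚ), Qr_eq_sum_runnerUpCoeff] <;>
    norm_num [Finset.sum_range_succ, runnerUpCoeff]

theorem mk_Qr_mul_denominator :
    PowerSeries.mk (fun G : ℕ => (Qr G : ℚ)) * ((1 - X) ^ 2 * (1 - X ^ 3) * (1 - X ^ 6) ^ 3) =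
      (1 + 4 * X ^ 2 + 3 * X ^ 3 + 6 * X ^ 4 + 5 * X ^ 5 + 17 * X ^ 6 - 2 * X ^ 7 + 19 * X ^ 8
        + 5 * X ^ 9 + 8 * X ^ 10 + 3 * X ^ 11 + 8 * X ^ 12 - 2 * X ^ 13 + 3 * X ^ 14 : ℚ⟦X⟧) := by
  have hnum : (1 + 4 * X ^ 2 + 3 * X ^ 3 + 6 * X ^ 4 + 5 * X ^ 5 + 17 * X ^ 6 - 2 * X ^ 7
    + 19 * X ^ 8 + 5 * X ^ 9 + 8 * X ^ 10 + 3 * X ^ 11 + 8 * X ^ 12 - 2 * X ^ 13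
    + 3 * X ^ 14 : ℚ⟦X⟧) =
      C 1 + C 4 * X ^ 2 + C 3 * X ^ 3 + C 6 * X ^ 4 + C 5 * X ^ 5 + C 17 * X ^ 6 - C 2 * X ^ 7
        + C 19 * X ^ 8 + C 5 * X ^ 9 + C 8 * X ^ 10 + C 3 * X ^ 11 + C 8 * X ^ 12 - C 2 * X ^ 13
        + C 3 * X ^ 14 := by
    simp only [map_ofNat, map_one]
  rw [hnum]
  ext n
  rw [coeff_mk_mul_denominator]
  simp only [map_add, map_sub, coeff_C_mul, coeff_X_pow, coeff_C]
  -- The denominator has degree 23: from there on all shifts are present and the recurrence applies.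
  rcases lt_or_ge n 23 with hn | hn
  · interval_cases n <;>
      norm_num [Qr_initial_values]
  · obtain ⟨m, rfl⟩ := Nat.exists_eq_add_of_le' hn
    have hm := Qr_recurrence m
    have hlt (i : ℕ) (hi : i < 23) : m + 23 ≠ i := by omega
    have hle (i : ℕ) (hi : i ≤ 23) : i ≤ m + 23 := by omega
    simp [hlt, hle]
    simpa using hm

theorem mk_Qr_eq :
    PowerSeries.mk (fun G : ℕ => (Qr G : ℚ)) =
      (1 + 4 * X ^ 2 + 3 * X ^ 3 + 6 * X ^ 4 + 5 * X ^ 5 + 17 * X ^ 6 - 2 * X ^ 7 + 19 * X ^ 8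
        + 5 * X ^ 9 + 8 * X ^ 10 + 3 * X ^ 11 + 8 * X ^ 12 - 2 * X ^ 13 + 3 * X ^ 14 : ℚ⟦X⟧) *
      ((1 - X) ^ 2 * (1 - X ^ 3) * (1 - X ^ 6) ^ 3)⁻¹ := by
  rw [PowerSeries.eq_mul_inv_iff_mul_eq (by simp)]
  exact mk_Qr_mul_denominator

end Series

/-! ### Degree and minimal period -/

theorem isQuasiPolynomial_runnerUp :
    IsQuasiPolynomial (fun n => ∑ i ∈ Finset.range 6, runnerUpCoeff i n * (n : ℚ) ^ i) 5 6 := by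
  refine ⟨runnerUpCoeff, fun _ => rfl, ⟨0, by norm_num [runnerUpCoeff]⟩, ⟨by norm_num, ?_⟩, ?_⟩
  · intro i _ n m
    exact runnerUpCoeff_congr i (by push_cast; omega)
  · rintro q ⟨hq, hper⟩
    -- A period `q` gives the constant coefficient the same value at `q` as at 0, namely 1, which
    -- forces `6 ∣ q`.
    have h := hper 0 (by norm_num) 0 1
    rw [(runnerUpCoeff_zero_eq_one_iff 0).2 (by norm_num), runnerUpCoeff_zero_eq_one_iff] at h
    omega

end ScoreSheet

theorem mainTheorem5 :
    (∀ G : ℕ, (ScoreSheet.runnerUpSheets G).Finite) ∧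
    (∃ Q : ℤ → ℚ, IsQuasiPolynomial Q 5 6 ∧ ∀ G : ℕ, (ScoreSheet.Qr G : ℚ) = Q (G : ℤ)) ∧
    (PowerSeries.mk (fun G : ℕ => (ScoreSheet.Qr G : ℚ)) =
      (1 + 4 * PowerSeries.X ^ 2 + 3 * PowerSeries.X ^ 3 + 6 * PowerSeries.X ^ 4
        + 5 * PowerSeries.X ^ 5 + 17 * PowerSeries.X ^ 6 - 2 * PowerSeries.X ^ 7
        + 19 * PowerSeries.X ^ 8 + 5 * PowerSeries.X ^ 9 + 8 * PowerSeries.X ^ 10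
        + 3 * PowerSeries.X ^ 11 + 8 * PowerSeries.X ^ 12 - 2 * PowerSeries.X ^ 13
        + 3 * PowerSeries.X ^ 14) *
      ((1 - PowerSeries.X) ^ 2 * (1 - PowerSeries.X ^ 3) * (1 - PowerSeries.X ^ 6) ^ 3)⁻¹) ∧
    (∀ G : ℕ,
      (G % 6 = 0 → (ScoreSheet.Qr G : ℚ) =
        1 + 59 / 45 * (G : ℚ) + 95 / 144 * (G : ℚ) ^ 2 + 215 / 1296 * (G : ℚ) ^ 3
          + 107 / 5184 * (G : ℚ) ^ 4 + 13 / 12960 * (G : ℚ) ^ 5) ∧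
      (G % 6 = 1 → (ScoreSheet.Qr G : ℚ) =
        713 / 1728 + 10957 / 12960 * (G : ℚ) + 1453 / 2592 * (G : ℚ) ^ 2 + 23 / 144 * (G : ℚ) ^ 3
          + 107 / 5184 * (G : ℚ) ^ 4 + 13 / 12960 * (G : ℚ) ^ 5) ∧
      (G % 6 = 2 → (ScoreSheet.Qr G : ℚ) =
        7 / 9 + 887 / 810 * (G : ℚ) + 775 / 1296 * (G : ℚ) ^ 2 + 23 / 144 * (G : ℚ) ^ 3
          + 107 / 5184 * (G : ℚ) ^ 4 + 13 / 12960 * (G : ℚ) ^ 5) ∧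
      (G % 6 = 3 → (ScoreSheet.Qr G : ℚ) =
        43 / 64 + 1573 / 1440 * (G : ℚ) + 181 / 288 * (G : ℚ) ^ 2 + 215 / 1296 * (G : ℚ) ^ 3
          + 107 / 5184 * (G : ℚ) ^ 4 + 13 / 12960 * (G : ℚ) ^ 5) ∧
      (G % 6 = 4 → (ScoreSheet.Qr G : ℚ) =
        20 / 27 + 431 / 405 * (G : ℚ) + 767 / 1296 * (G : ℚ) ^ 2 + 23 / 144 * (G : ℚ) ^ 3
          + 107 / 5184 * (G : ℚ) ^ 4 + 13 / 12960 * (G : ℚ) ^ 5) ∧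
      (G % 6 = 5 → (ScoreSheet.Qr G : ℚ) =
        259 / 576 + 11357 / 12960 * (G : ℚ) + 1469 / 2592 * (G : ℚ) ^ 2 + 23 / 144 * (G : ℚ) ^ 3
          + 107 / 5184 * (G : ℚ) ^ 4 + 13 / 12960 * (G : ℚ) ^ 5)) := by
  refine ⟨ScoreSheet.finite_runnerUpSheets,
    ⟨_, ScoreSheet.isQuasiPolynomial_runnerUp, ScoreSheet.Qr_eq_sum_runnerUpCoeff⟩,
    ScoreSheet.mk_Qr_eq, fun G => ?_⟩
  exact ⟨ScoreSheet.Qr_of_mod_six_eq_zero, ScoreSheet.Qr_of_mod_six_eq_one,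
    ScoreSheet.Qr_of_mod_six_eq_two, ScoreSheet.Qr_of_mod_six_eq_three,
    ScoreSheet.Qr_of_mod_six_eq_four, ScoreSheet.Qr_of_mod_six_eq_five⟩
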